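/- Let $N$ be a smooth real $n$-manifold and $(N,F)$ a Finsler manifold: $F:TN\to[0,\infty)$ is smooth on the slit tangent bundle $TN^0$ (the complement of the zero section), vanishes exactly on the zero section, is positively homogeneous of degree one on the fibres, and in the coordinates $(x^a,y^a)$ of $TN$ induced by any chart $(x^a)$ of $N$ the matrix $g_{ab}=\frac12\frac{\partial^2F^2}{\partial y^a\partial y^b}$ is positive definite on $TN^0$. Let $[g^{ab}]$ be the inverse matrix and put $$G^a=\tfrac14 g^{ab}\Big(\frac{\partial^2F^2}{\partial y^b\partial x^c}y^c-\frac{\partial F^2}{\partial x^b}\Big),\quad G^a_b=\frac{\partial G^a}{\partial y^b},\quad \frac{\delta}{\delta x^a}=\frac{\partial}{\partial x^a}-G^b_a\frac{\partial}{\partial y^b},\quad \delta y^a=dy^a+G^a_b\,dx^b .$$ Let $V(N)$ and $H(N)$ be the distributions on $TN^0$ spanned by the $\partial/\partial y^a$ and by the $\delta/\delta x^a$, $G=g_{ab}dx^adx^b+g_{ab}\delta y^a\delta y^b$ the Sasaki–Finsler metric, and $\theta_F=\frac12\frac{\partial F^2}{\partial y^a}dx^a$ the Cartan form. For a distribution $\mathcal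 D$, a complementary distribution $\mathcal D'$ and the projector $P$ onto $\mathcal D$ along $\mathcal D'$, the Weyl connection of $\mathcal D$ is the linear connection $\nabla$ on $\mathcal D$ such that $\nabla_{PX}G+\theta_F(PX)\,G=0$ on $\mathcal D$ and $\nabla_XPY=\nabla_{PY}PX+P[X,PY]$ for all vector fields $X,Y$. Let $\nabla$ and $\nabla^\perp$ be the Weyl connections of $V(N)$ (with complement $H(N)$) and of $H(N)$ (with complement $V(N)$), and let $Q,Q^\perp$ be the projectors onto $V(N)$ and $H(N)$. The Vranceanu connection of $(TN,F,\theta_F)$ is $\nabla^*_XY=\nabla_XQY+\nabla^\perp_XQ^\perp Y$, and its coefficients $F^c_{ab}$ in a chart are defined by $\nabla^*_{\delta/\delta x^b}\frac{\delta}{\delta x^a}=F^c_{ab}\frac{\delta}{\delta x^c}$. **Corollary 3.6.** In the coordinates induced by every chart of $N$ the Vranceanu connection of $(TN,F,\theta_F)$ exists. Moreover: 1. If $(N,F)$ is a Landsberg space, that is, if in every chart $$\tfrac12g^{cd}\Big(\frac{\delta g_{db}}{\delta x^a}+\frac{\delta g_{ad}}{\delta x^b}-\frac{\delta g_{ab}}{\delta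 x^d}\Big)=\frac{\partial G^c_a}{\partial y^b},$$ then in every chart of $N$, at every point of $TN^0$ over it, $$F^c_{ab}=\frac{\partial^2G^c}{\partial y^a\partial y^b}+\tfrac12y^u\big(g_{ub}\delta^c_a+g_{au}\delta^c_b-g_{ab}\delta^c_u\big).$$ 2. If $(N,F)$ is a locally Minkowski space, that is, if $N$ has a covering by charts in which $g_{ab}=g_{ab}(y)$ does not depend on $x$, then in every chart of such a covering, at every point of $TN^0$ over it, $$F^c_{ab}=\tfrac12y^u\big(g_{ub}\delta^c_a+g_{au}\delta^c_b-g_{ab}\delta^c_u\big).$$ -/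

import Mathlib

open scoped Manifold ContDiff

noncomputable section

namespace FinslerWeyl

/-! ### Connections on distributions of an open set of a normed space

A distribution on an open set `Ω` of `V` together with a complementary distribution is given by the
field `P` of projectors onto it. Vector fields, one-forms and metrics are functions on `V` that are
only looked at on `Ω`. -/

section Connections

variable {V : Type*} [NormedAddCommGroup V] [NormedSpace ℝ V]

/-- `X` is a smooth vector field on `Ω`. -/
def IsField (Ω : Set V) (X : V → V) : Prop :=
  ContDiffOn ℝ ∞ X Ω

/-- The vector field `P X`. -/
def proj (P : V → V → V) (X : V → V) : V → V :=
  fun p => P p (X p)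

/-- `Y` is a smooth section over `Ω` of the distribution onto which `P` projects. -/
def IsSection (Ω : Set V) (P : V → V → V) (Y : V → V) : Prop :=
  IsField Ω Y ∧ ∀ p ∈ Ω, P p (Y p) = Y p

/-- `D X Y = ∇_X Y` is a linear connection, over `Ω`, on the distribution onto which `P`
projects. -/
structure IsLinearConnection (Ω : Set V) (P : V → V → V)
    (D : (V → V) → (V → V) → V → V) : Prop where
  isSection : ∀ X Y, IsField Ω X → IsSection Ω P Y → IsSection Ω P (D X Y)
  add_left : ∀ X X' Y, IsField Ω X → IsField Ω X' → IsSection Ω P Y →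
    ∀ p ∈ Ω, D (X + X') Y p = D X Y p + D X' Y p
  smul_left : ∀ (f : V → ℝ) X Y, ContDiffOn ℝ ∞ f Ω → IsField Ω X → IsSection Ω P Y →
    ∀ p ∈ Ω, D (fun q => f q • X q) Y p = f p • D X Y p
  add_right : ∀ X Y Y', IsField Ω X → IsSection Ω P Y → IsSection Ω P Y' →
    ∀ p ∈ Ω, D X (Y + Y') p = D X Y p + D X Y' p
  leibniz : ∀ (f : V → ℝ) X Y, ContDiffOn ℝ ∞ f Ω → IsField Ω X → IsSection Ω P Y →
    ∀ p ∈ Ω, D X (fun q => f q • Y q) p = fderiv ℝ f p (X p) • Y p + f p • D X Y p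

/-- Compatibility with the Weyl substructure with metric `g` and one-form `W = W(g)`:
`∇_{PX} g + W(PX) g = 0` on the distribution, for all vector fields `X`. -/
def IsWeylCompatible (Ω : Set V) (P : V → V → V) (g : V → V → V → ℝ) (W : V → V → ℝ)
    (D : (V → V) → (V → V) → V → V) : Prop :=
  ∀ X Y Z, IsField Ω X → IsSection Ω P Y → IsSection Ω P Z → ∀ p ∈ Ω,
    (fderiv ℝ (fun q => g q (Y q) (Z q)) p (proj P X p)
        - g p (D (proj P X) Y p) (Z p) - g p (Y p) (D (proj P X) Z p))
      + W p (proj P X p) * g p (Y p) (Z p) = 0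

/-- Torsion-freeness with respect to the complementary distribution `ker P`:
`∇_X PY = ∇_{PY} PX + P[X, PY]` for all vector fields `X`, `Y`. -/
def IsTorsionFree (Ω : Set V) (P : V → V → V) (D : (V → V) → (V → V) → V → V) : Prop :=
  ∀ X Y, IsField Ω X → IsField Ω Y → ∀ p ∈ Ω,
    D X (proj P Y) p
      = D (proj P Y) (proj P X) p + P p (VectorField.lieBracket ℝ X (proj P Y) p)

/-- `D` is the Weyl connection of `(Ω, g, W)` on the distribution onto which `P` projects, with
complementary distribution `ker P`. -/
structure IsWeylConnection (Ω : Set V) (P : V → V → V) (g : V → V → V → ℝ) (W : V → V → ℝ)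
    (D : (V → V) → (V → V) → V → V) : Prop where
  linear : IsLinearConnection Ω P D
  compatible : IsWeylCompatible Ω P g W D
  torsionFree : IsTorsionFree Ω P D

/-- `D` is the Vranceanu connection of the Weyl manifold `(Ω, g, W)` with orthogonal distributions
given by the projectors `Q` and `Q'`: it is `∇*_X Y = ∇_X QY + ∇'_X Q'Y` with `∇` the intrinsic
and `∇'` the transversal Weyl connection. -/
def IsVranceanuConnection (Ω : Set V) (Q Q' : V → V → V) (g : V → V → V → ℝ) (W : V → V → ℝ)
    (D : (V → V) → (V → V) → V → V) : Prop :=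
  ∃ D₁ D₂ : (V → V) → (V → V) → V → V,
    IsWeylConnection Ω Q g W D₁ ∧ IsWeylConnection Ω Q' g W D₂ ∧
    ∀ X Y, IsField Ω X → IsField Ω Y → ∀ p ∈ Ω,
      D X Y p = D₁ X (proj Q Y) p + D₂ X (proj Q' Y) p

end Connections

/-! ### Finsler geometry in induced coordinates

Points of `TCoord n` are pairs `(x, y)`, the coordinates that a chart `x` of `N` induces on `TN`;
`L` stands for the local expression of the Finsler function. -/

/-- The model space of `n`-dimensional manifolds. -/
abbrev Coord (n : ℕ) : Type := EuclideanSpace ℝ (Fin n)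

/-- The coordinate space `(x, y)` of the tangent bundle. -/
abbrev TCoord (n : ℕ) : Type := Coord n × Coord n

section Local

variable {n : ℕ}

/-- The `a`-th standard basis vector. -/
def e (a : Fin n) : Coord n := EuclideanSpace.single a (1 : ℝ)

/-- `∂f/∂x^a`. -/
def dx (a : Fin n) (f : TCoord n → ℝ) (p : TCoord n) : ℝ := fderiv ℝ f p (e a, 0)

/-- `∂f/∂y^a`. -/
def dy (a : Fin n) (f : TCoord n → ℝ) (p : TCoord n) : ℝ := fderiv ℝ f p (0, e a)

variable (L : TCoord n → ℝ)

/-- `F²`. -/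
def sqF (p : TCoord n) : ℝ := L p ^ 2

/-- `g_{ab} = ½ ∂²F²/∂y^a∂y^b`. -/
def gLow (a b : Fin n) (p : TCoord n) : ℝ := 1 / 2 * dy a (dy b (sqF L)) p

/-- The matrix `[g_{ab}]` at a point. -/
def gMat (p : TCoord n) : Matrix (Fin n) (Fin n) ℝ := Matrix.of fun a b => gLow L a b p

/-- `g^{ab}`, the entries of the inverse matrix. -/
def gUp (a b : Fin n) (p : TCoord n) : ℝ := (gMat L p)⁻¹ a b

/-- `G^a = ¼ g^{ab} (∂²F²/∂y^b∂x^c y^c - ∂F²/∂x^b)`. -/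
def spray (a : Fin n) (p : TCoord n) : ℝ :=
  1 / 4 * ∑ b, gUp L a b p * ((∑ c, dy b (dx c (sqF L)) p * p.2 c) - dx b (sqF L) p)

/-- `G^a_b = ∂G^a/∂y^b`. -/
def nlc (a b : Fin n) (p : TCoord n) : ℝ := dy b (spray L a) p

/-- The derivative `δf/δx^a = ∂f/∂x^a - G^b_a ∂f/∂y^b` of a function. -/
def ddelta (a : Fin n) (f : TCoord n → ℝ) (p : TCoord n) : ℝ :=
  dx a f p - ∑ b, nlc L b a p * dy b f p

/-- The vector field `δ/δx^a = ∂/∂x^a - G^b_a ∂/∂y^b`. -/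
def deltaField (a : Fin n) (p : TCoord n) : TCoord n := (e a, -∑ b, nlc L b a p • e b)

/-- The one-form `δy^a = dy^a + G^a_b dx^b`. -/
def deltaY (a : Fin n) (p ξ : TCoord n) : ℝ := ξ.2 a + ∑ b, nlc L a b p * ξ.1 b

/-- The projector onto the vertical distribution, along the horizontal one. -/
def vert (p ξ : TCoord n) : TCoord n := (0, ∑ a, deltaY L a p ξ • e a)

/-- The projector onto the horizontal distribution, along the vertical one. -/
def horiz (p ξ : TCoord n) : TCoord n := ∑ a, ξ.1 a • deltaField L a p

/-- The Sasaki-Finsler metric `g_{ab} dx^a dx^b + g_{ab} δy^a δy^b`. -/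
def sasaki (p ξ η : TCoord n) : ℝ :=
  ∑ a, ∑ b, gLow L a b p * (ξ.1 a * η.1 b + deltaY L a p ξ * deltaY L b p η)

/-- The Cartan form `θ_F = ½ ∂F²/∂y^a dx^a`. -/
def cartanForm (p ξ : TCoord n) : ℝ := ∑ a, 1 / 2 * dy a (sqF L) p * ξ.1 a

/-- `½ y^u (g_{ub} δ^c_a + g_{au} δ^c_b - g_{ab} δ^c_u)`. -/
def yTerm (c a b : Fin n) (p : TCoord n) : ℝ :=
  1 / 2 * ∑ u, p.2 u * (gLow L u b p * (if c = a then 1 else 0)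
    + gLow L a u p * (if c = b then 1 else 0) - gLow L a b p * (if c = u then 1 else 0))

end Local

/-! ### Finsler manifolds -/

section Finsler

variable {n : ℕ} {N : Type*} [TopologicalSpace N] [ChartedSpace (Coord n) N]

/-- The local expression `F(x, y)` of `F : TN → ℝ` in the coordinates of `TN` induced by `φ`, that
is, `F` at the tangent vector `y^a ∂/∂x^a` at the point with coordinates `x`. -/
def localF (F : TangentBundle (𝓡 n) N → ℝ) (φ : OpenPartialHomeomorph N (Coord n))
    (p : TCoord n) : ℝ :=
  F ⟨φ.symm p.1, mfderiv (𝓡 n) (𝓡 n) φ.symm p.1 p.2⟩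

/-- The range of the coordinates induced by `φ` on the slit tangent bundle `TN⁰`. -/
def slitDomain (φ : OpenPartialHomeomorph N (Coord n)) : Set (TCoord n) :=
  {p | p.1 ∈ φ.target ∧ p.2 ≠ 0}

/-- `(N, F)` is a Finsler manifold. -/
structure IsFinsler [IsManifold (𝓡 n) ∞ N] (F : TangentBundle (𝓡 n) N → ℝ) : Prop where
  nonneg : ∀ v, 0 ≤ F v
  smooth : ContMDiffOn (𝓡 n).tangent 𝓘(ℝ) ∞ F {v | v.2 ≠ 0}
  eq_zero_iff : ∀ v, F v = 0 ↔ v.2 = 0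
  homogeneous : ∀ (x : N) (v : TangentSpace (𝓡 n) x) (t : ℝ), 0 < t →
    F ⟨x, t • v⟩ = t * F ⟨x, v⟩
  posDef : ∀ φ ∈ IsManifold.maximalAtlas (𝓡 n) ∞ N, ∀ p ∈ slitDomain φ,
    (gMat (localF F φ) p).PosDef

/-- Landsberg space: `½ g^{cd} (δg_{db}/δx^a + δg_{ad}/δx^b - δg_{ab}/δx^d) = ∂G^c_a/∂y^b` in all
charts. -/
def IsLandsberg [IsManifold (𝓡 n) ∞ N] (F : TangentBundle (𝓡 n) N → ℝ) : Prop :=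
  ∀ φ ∈ IsManifold.maximalAtlas (𝓡 n) ∞ N, ∀ p ∈ slitDomain φ, ∀ a b c : Fin n,
    1 / 2 * ∑ d, gUp (localF F φ) c d p *
        (ddelta (localF F φ) a (gLow (localF F φ) d b) p
          + ddelta (localF F φ) b (gLow (localF F φ) a d) p
          - ddelta (localF F φ) d (gLow (localF F φ) a b) p)
      = dy b (nlc (localF F φ) c a) p

/-- `A` is a covering of `N` by charts in which `g_{ab}` does not depend on `x`. A locally Minkowski
space is a Finsler manifold that has such a covering. -/
def IsMinkowskiCovering [IsManifold (𝓡 n) ∞ N] (F : TangentBundle (𝓡 n) N → ℝ)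
    (A : Set (OpenPartialHomeomorph N (Coord n))) : Prop :=
  A ⊆ IsManifold.maximalAtlas (𝓡 n) ∞ N ∧ (∀ x : N, ∃ φ ∈ A, x ∈ φ.source) ∧
    ∀ φ ∈ A, ∀ x ∈ φ.target, ∀ x' ∈ φ.target, ∀ y : Coord n, y ≠ 0 → ∀ a b : Fin n,
      gLow (localF F φ) a b (x, y) = gLow (localF F φ) a b (x', y)

/-- `D` is, in the coordinates induced by `φ`, the Vranceanu connection of the Weyl manifold
`(TN, F, θ_F)`: the Sasaki-Finsler metric with the Cartan form, the vertical distribution as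
structural and the horizontal distribution as transversal one. -/
def IsFinslerVranceanu (F : TangentBundle (𝓡 n) N → ℝ) (φ : OpenPartialHomeomorph N (Coord n))
    (D : (TCoord n → TCoord n) → (TCoord n → TCoord n) → TCoord n → TCoord n) : Prop :=
  IsVranceanuConnection (slitDomain φ) (vert (localF F φ)) (horiz (localF F φ))
    (sasaki (localF F φ)) (cartanForm (localF F φ)) D

end Finsler

end FinslerWeyl

end

/-! The argument is the Levi-Civita one, carried out for a distribution in a frame `E` whose
brackets are killed by the projector. In such a frame torsion-freeness makes the coefficients
symmetric. Metric compatibility then determines them by the Koszul trick: they are the Christoffel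
symbols of the frame components of the metric, plus terms linear in the one-form. Conversely, these
coefficients together with the projected Lie bracket along the complement define a Weyl connection
(`isWeylConnection`, `weylConnection_frame`).

Both distributions have such frames: the `∂/∂y^a` commute, and the brackets of the `δ/δx^a` are
vertical. This gives existence. Since `δ/δx^a` has no vertical part, only the horizontal Weyl
connection enters `F^c_{ab}`. Euler's identity for `∂F²/∂y^b` gives the Cartan form the components
`g_{ab} y^a`; raising an index turns its contribution into `yTerm`, so `F^c_{ab}` is a horizontal
Christoffel symbol plus `yTerm` (`weylCoeff_deltaField`).

The Landsberg condition says that this Christoffel symbol is a second `y`-derivative of the spray.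
In the Minkowski case `F² = g_{ab} y^a y^b` is free of `x`, so the spray and the nonlinear
connection vanish, and with them the Christoffel symbol. -/

namespace FinslerWeyl

/-! ### Weyl connections in an adapted frame. -/

section FrameConnection

/-- The algebraic content of metric compatibility in components. -/
theorem sum_metric_identity {ι : Type*} [Fintype ι] {M dM A : ι → ι → ℝ} {t : ℝ} (hM : ∀ a b, M a b = M b a)
    (hdM : ∀ a b, dM a b + t * M a b = ∑ c, M a c * A c b + ∑ c, M b c * A c a)
    (y z dy dz : ι → ℝ) :
    ∑ a, ∑ b, (dM a b * (y a * z b) + M a b * (dy a * z b + y a * dz b))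
      - ∑ a, ∑ b, M a b * ((dy a + ∑ c, A a c * y c) * z b)
      - ∑ a, ∑ b, M a b * (y a * (dz b + ∑ c, A b c * z c))
      + t * ∑ a, ∑ b, M a b * (y a * z b) = 0 := by
  have e1 : ∑ a, ∑ b, M a b * ((∑ c, A a c * y c) * z b) =
      ∑ a, ∑ b, y a * z b * ∑ c, M b c * A c a := by
    simp only [Finset.sum_mul, Finset.mul_sum]
    rw [Finset.sum_congr rfl fun a _ => Finset.sum_comm, Finset.sum_comm]
    refine Finset.sum_congr rfl fun a _ => ?_
    rw [Finset.sum_comm]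
    refine Finset.sum_congr rfl fun b _ => Finset.sum_congr rfl fun c _ => ?_
    rw [hM c b]; ring
  have e2 : ∑ a, ∑ b, M a b * (y a * ∑ c, A b c * z c) =
      ∑ a, ∑ b, y a * z b * ∑ c, M a c * A c b := by
    simp only [Finset.mul_sum]
    refine Finset.sum_congr rfl fun a _ => ?_
    rw [Finset.sum_comm]
    exact Finset.sum_congr rfl fun b _ => Finset.sum_congr rfl fun c _ => by ring
  have e3 : ∀ a b, dM a b * (y a * z b) = y a * z b * ∑ c, M a c * A c b
      + y a * z b * ∑ c, M b c * A c a - t * (M a b * (y a * z b)) := fun a b => by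
    linear_combination (y a * z b) * hdM a b
  simp only [add_mul, mul_add, e3, Finset.sum_add_distrib, Finset.sum_sub_distrib, e1, e2,
    ← Finset.mul_sum]
  ring

variable {V : Type*} [NormedAddCommGroup V] [NormedSpace ℝ V] {ι : Type*} [Fintype ι]
  [DecidableEq ι]

/-- A frame `E` of the distribution onto which `P` projects, with dual forms `ε` vanishing on
`ker P`, whose brackets lie in `ker P`; `G` and `w` are the components of the metric and the
one-form in this frame. -/
structure AdaptedFrame (Ω : Set V) (P : V → V → V) (g : V → V → V → ℝ) (W : V → V → ℝ)
    (E : ι → V → V) (ε : ι → V → V →L[ℝ] ℝ) (G : ι → ι → V → ℝ) (w : ι → V → ℝ) : Prop where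
  isOpen : IsOpen Ω
  proj_eq : ∀ p ξ, P p ξ = ∑ a, ε a p ξ • E a p
  dual : ∀ p a b, ε a p (E b p) = if a = b then 1 else 0
  smooth_frame : ∀ a, ContDiffOn ℝ ∞ (E a) Ω
  smooth_dual : ∀ a, ContDiffOn ℝ ∞ (ε a) Ω
  smooth_metric : ∀ a b, ContDiffOn ℝ ∞ (G a b) Ω
  smooth_form : ∀ a, ContDiffOn ℝ ∞ (w a) Ω
  posDef : ∀ p ∈ Ω, (Matrix.of fun a b => G a b p).PosDef
  metric_eq : ∀ p ξ η, P p ξ = ξ → P p η = η →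
    g p ξ η = ∑ a, ∑ b, G a b p * (ε a p ξ * ε b p η)
  form_eq : ∀ p ξ, P p ξ = ξ → W p ξ = ∑ a, w a p * ε a p ξ
  bracket : ∀ p ∈ Ω, ∀ a b, P p (VectorField.lieBracket ℝ (E a) (E b) p) = 0

/-- Twice the Christoffel symbols of the first kind of the Weyl structure in the frame `E`. -/
noncomputable def weylKoszul (E : ι → V → V) (G : ι → ι → V → ℝ) (w : ι → V → ℝ) (d a b : ι)
    (p : V) : ℝ :=
  (fderiv ℝ (G d b) p (E a p) + fderiv ℝ (G a d) p (E b p) - fderiv ℝ (G a b) p (E d p))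
    + (w a p * G d b p + w b p * G a d p - w d p * G a b p)

/-- The connection coefficients of the Weyl structure in the frame `E`. -/
noncomputable def weylCoeff (E : ι → V → V) (G : ι → ι → V → ℝ) (w : ι → V → ℝ) (c a b : ι)
    (p : V) : ℝ :=
  1 / 2 * ∑ d, (Matrix.of fun i j => G i j p)⁻¹ c d * weylKoszul E G w d a b p

/-- The connection on the distribution onto which `P` projects with coefficients `Γ` along the
distribution and given by the Lie bracket along `ker P`. -/
noncomputable def frameConnection (P : V → V → V) (E : ι → V → V) (ε : ι → V → V →L[ℝ] ℝ)
    (Γ : ι → ι → ι → V → ℝ) (X Y : V → V) (p : V) : V :=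
  ∑ c, (fderiv ℝ (fun q => ε c q (Y q)) p (P p (X p))
      + ∑ a, ∑ b, Γ c a b p * (ε a p (X p) * ε b p (Y p))) • E c p
    + P p (VectorField.lieBracket ℝ (X - proj P X) Y p)

/-- The entries of the inverse of a matrix depending smoothly on a parameter are smooth. -/
theorem contDiffOn_inv_apply {Ω : Set V} {G : ι → ι → V → ℝ}
    (hG : ∀ a b, ContDiffOn ℝ ∞ (G a b) Ω)
    (hdet : ∀ p ∈ Ω, (Matrix.of fun a b => G a b p).det ≠ 0) (c d : ι) :
    ContDiffOn ℝ ∞ (fun p => (Matrix.of fun i j => G i j p)⁻¹ c d) Ω := by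
  have key : ∀ H : ι → ι → V → ℝ, (∀ a b, ContDiffOn ℝ ∞ (H a b) Ω) →
      ContDiffOn ℝ ∞ (fun p => (Matrix.of fun a b => H a b p).det) Ω := by
    intro H hH
    simp only [Matrix.det_apply, Matrix.of_apply]
    refine ContDiffOn.sum fun σ _ => ContDiffOn.const_smul _ ?_
    exact contDiffOn_prod fun i _ => hH _ _
  -- Cramer's rule: the adjugate entry is the determinant with row `d` replaced by the `c`-th unit
  -- vector, so smoothness of determinants suffices.
  have h2 : ∀ p, (Matrix.of fun i j => G i j p)⁻¹ c d = ((Matrix.of fun i j => G i j p).det)⁻¹ *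
      (Matrix.of fun i j => (if i = d then fun _ => Pi.single (M := fun _ => ℝ) c 1 j
        else G i j) p).det := by
    intro p
    rw [Matrix.inv_def, Matrix.smul_apply, Matrix.adjugate_apply, Ring.inverse_eq_inv', smul_eq_mul]
    congr 2
    ext i j
    by_cases hi : i = d
    · subst hi; simp
    · simp [hi]
  simp only [h2]
  refine ContDiffOn.mul ((key G hG).inv hdet) (key _ fun a b => ?_)
  split_ifs
  · exact contDiffOn_const
  · exact hG _ _

theorem contDiffOn_fderiv_apply {Ω : Set V} (hΩ : IsOpen Ω) {W : Type*}
    [NormedAddCommGroup W] [NormedSpace ℝ W] {f : V → W} {v : V → V}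
    (hf : ContDiffOn ℝ ∞ f Ω) (hv : ContDiffOn ℝ ∞ v Ω) :
    ContDiffOn ℝ ∞ (fun p => fderiv ℝ f p (v p)) Ω :=
  (hf.fderiv_of_isOpen hΩ (m := ∞) le_rfl).clm_apply hv

namespace AdaptedFrame

variable {Ω : Set V} {P : V → V → V} {g : V → V → V → ℝ} {W : V → V → ℝ}
    {E : ι → V → V} {ε : ι → V → V →L[ℝ] ℝ} {G : ι → ι → V → ℝ} {w : ι → V → ℝ}

theorem det_ne_zero (h : AdaptedFrame Ω P g W E ε G w) {p : V} (hp : p ∈ Ω) :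
    (Matrix.of fun a b => G a b p).det ≠ 0 := (h.posDef p hp).det_pos.ne'

theorem metric_symm (h : AdaptedFrame Ω P g W E ε G w) {p : V} (hp : p ∈ Ω) (a b : ι) :
    G a b p = G b a p := by
  simpa using ((h.posDef p hp).isHermitian.apply a b).symm

theorem fderiv_metric_symm (h : AdaptedFrame Ω P g W E ε G w) {p : V} (hp : p ∈ Ω) (a b : ι) :
    fderiv ℝ (G a b) p = fderiv ℝ (G b a) p :=
  Filter.EventuallyEq.fderiv_eq <| Filter.eventuallyEq_of_mem (h.isOpen.mem_nhds hp)
    fun _ hq => h.metric_symm hq a b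

theorem dual_sum (h : AdaptedFrame Ω P g W E ε G w) (p : V) (s : ι → ℝ) (c : ι) :
    ε c p (∑ a, s a • E a p) = s c := by
  simp [map_sum, h.dual]

theorem dual_proj (h : AdaptedFrame Ω P g W E ε G w) (p ξ : V) (c : ι) :
    ε c p (P p ξ) = ε c p ξ := by
  rw [h.proj_eq, h.dual_sum]

theorem proj_sum (h : AdaptedFrame Ω P g W E ε G w) (p : V) (s : ι → ℝ) :
    P p (∑ a, s a • E a p) = ∑ a, s a • E a p := by
  rw [h.proj_eq]; simp only [h.dual_sum]

theorem proj_proj (h : AdaptedFrame Ω P g W E ε G w) (p ξ : V) : P p (P p ξ) = P p ξ := by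
  rw [h.proj_eq p ξ, h.proj_sum]

theorem proj_frame (h : AdaptedFrame Ω P g W E ε G w) (p : V) (a : ι) :
    P p (E a p) = E a p := by
  rw [h.proj_eq]; simp [h.dual]

theorem ext_dual (h : AdaptedFrame Ω P g W E ε G w) {p ξ η : V} (hξ : P p ξ = ξ) (hη : P p η = η)
    (H : ∀ c, ε c p ξ = ε c p η) : ξ = η := by
  rw [← hξ, ← hη, h.proj_eq, h.proj_eq]; simp only [H]

theorem proj_add (h : AdaptedFrame Ω P g W E ε G w) (p ξ η : V) :
    P p (ξ + η) = P p ξ + P p η := by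
  simp [h.proj_eq, add_smul, Finset.sum_add_distrib]

theorem proj_smul (h : AdaptedFrame Ω P g W E ε G w) (p : V) (t : ℝ) (ξ : V) :
    P p (t • ξ) = t • P p ξ := by
  simp [h.proj_eq, mul_smul, Finset.smul_sum]

theorem contDiffOn_dual (h : AdaptedFrame Ω P g W E ε G w) {X : V → V} (hX : IsField Ω X) (a : ι) :
    ContDiffOn ℝ ∞ (fun q => ε a q (X q)) Ω := (h.smooth_dual a).clm_apply hX

theorem isField_proj (h : AdaptedFrame Ω P g W E ε G w) {X : V → V} (hX : IsField Ω X) :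
    IsField Ω (proj P X) := by
  have : proj P X = fun p => ∑ a, ε a p (X p) • E a p := funext fun p => h.proj_eq p _
  rw [this]
  exact ContDiffOn.sum fun a _ => (h.contDiffOn_dual hX a).smul (h.smooth_frame a)

theorem isSection_frame (h : AdaptedFrame Ω P g W E ε G w) (a : ι) : IsSection Ω P (E a) :=
  ⟨h.smooth_frame a, fun p _ => h.proj_frame p a⟩

theorem differentiableAt (h : AdaptedFrame Ω P g W E ε G w) {F : Type*} [NormedAddCommGroup F]
    [NormedSpace ℝ F] {f : V → F} (hf : ContDiffOn ℝ ∞ f Ω) {p : V} (hp : p ∈ Ω) :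
    DifferentiableAt ℝ f p :=
  (hf.contDiffAt (h.isOpen.mem_nhds hp)).differentiableAt (by simp)

theorem differentiableAt_sub_proj (h : AdaptedFrame Ω P g W E ε G w) {X : V → V}
    (hX : IsField Ω X) {p : V} (hp : p ∈ Ω) : DifferentiableAt ℝ (X - proj P X) p :=
  h.differentiableAt (ContDiffOn.sub hX (h.isField_proj hX)) hp

theorem isField_lieBracket (h : AdaptedFrame Ω P g W E ε G w) {X Y : V → V} (hX : IsField Ω X)
    (hY : IsField Ω Y) : IsField Ω (VectorField.lieBracket ℝ X Y) := fun _ hp =>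
  ((hX.contDiffAt (h.isOpen.mem_nhds hp)).lieBracket_vectorField
    (hY.contDiffAt (h.isOpen.mem_nhds hp)) (m := ∞) le_rfl).contDiffWithinAt

/-- The frame brackets lie in the kernel of every `ε c`, so the bracket of two sections has the same
component formula as in a coordinate frame. -/
theorem dual_lieBracket_proj (h : AdaptedFrame Ω P g W E ε G w) {X Y : V → V} (hX : IsField Ω X)
    (hY : IsField Ω Y) {p : V} (hp : p ∈ Ω) (c : ι) :
    ε c p (VectorField.lieBracket ℝ (proj P X) (proj P Y) p) =
      fderiv ℝ (fun q => ε c q (Y q)) p (P p (X p))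
        - fderiv ℝ (fun q => ε c q (X q)) p (P p (Y p)) := by
  have key : ∀ Z : V → V, IsField Ω Z → ∀ v, ε c p (fderiv ℝ (proj P Z) p v) =
      fderiv ℝ (fun q => ε c q (Z q)) p v + ∑ b, ε b p (Z p) * ε c p (fderiv ℝ (E b) p v) := by
    intro Z hZ v
    have : proj P Z = fun p => ∑ a, ε a p (Z p) • E a p := funext fun p => h.proj_eq p _
    have hd : ∀ a, HasFDerivAt (fun q => ε a q (Z q) • E a q) _ p := fun a =>
      (h.differentiableAt (h.contDiffOn_dual hZ a) hp).hasFDerivAt.fun_smul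
        (h.differentiableAt (h.smooth_frame a) hp).hasFDerivAt
    rw [this, (HasFDerivAt.fun_sum fun a _ => hd a).fderiv]
    simp [map_sum, h.dual, Finset.sum_add_distrib, add_comm]
  -- This symmetry cancels the terms in which the frame itself is differentiated.
  have hbr : ∀ a b, ε c p (fderiv ℝ (E b) p (E a p)) = ε c p (fderiv ℝ (E a) p (E b p)) := by
    intro a b
    have := congrArg (ε c p) (h.bracket p hp a b)
    rw [h.dual_proj, VectorField.lieBracket, map_sub, map_zero] at this
    linarith
  rw [VectorField.lieBracket, map_sub, key Y hY, key X hX]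
  have : ∑ b, ε b p (Y p) * ε c p (fderiv ℝ (E b) p (proj P X p)) =
      ∑ b, ε b p (X p) * ε c p (fderiv ℝ (E b) p (proj P Y p)) := by
    simp only [proj, h.proj_eq p, map_sum, map_smul, smul_eq_mul, Finset.mul_sum]
    rw [Finset.sum_comm]
    refine Finset.sum_congr rfl fun a _ => Finset.sum_congr rfl fun b _ => ?_
    rw [hbr a b]; ring
  rw [this]; simp only [proj]; ring

/-! ### Christoffel symbols of the Weyl structure. -/

section Coefficients

theorem weylKoszul_swap (h : AdaptedFrame Ω P g W E ε G w) {p : V} (hp : p ∈ Ω) (d a b : ι) :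
    weylKoszul E G w d a b p = weylKoszul E G w d b a p := by
  simp only [weylKoszul]
  rw [h.fderiv_metric_symm hp d b, h.fderiv_metric_symm hp a d, h.fderiv_metric_symm hp a b,
    h.metric_symm hp d b, h.metric_symm hp a d, h.metric_symm hp a b]
  ring

theorem weylCoeff_swap (h : AdaptedFrame Ω P g W E ε G w) {p : V} (hp : p ∈ Ω) (c a b : ι) :
    weylCoeff E G w c a b p = weylCoeff E G w c b a p := by
  simp only [weylCoeff, h.weylKoszul_swap hp _ a b]

theorem sum_metric_mul_weylCoeff (h : AdaptedFrame Ω P g W E ε G w) {p : V} (hp : p ∈ Ω)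
    (d a b : ι) :
    ∑ c, G d c p * weylCoeff E G w c a b p = 1 / 2 * weylKoszul E G w d a b p := by
  have hinv := Matrix.mul_nonsing_inv (Matrix.of fun i j => G i j p)
    (isUnit_iff_ne_zero.2 (h.det_ne_zero hp))
  have : (fun c => weylCoeff E G w c a b p) = (1 / 2 : ℝ) •
      (Matrix.of fun i j => G i j p)⁻¹.mulVec (fun d => weylKoszul E G w d a b p) := by
    ext c; simp [weylCoeff, Matrix.mulVec, dotProduct]
  have h2 := congrArg (fun v => (Matrix.of fun i j => G i j p).mulVec v d) this
  simp only [Matrix.mulVec_smul, Matrix.mulVec_mulVec, hinv, Matrix.one_mulVec] at h2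
  simpa [Matrix.mulVec, dotProduct] using h2

theorem eq_weylCoeff (h : AdaptedFrame Ω P g W E ε G w) {p : V} (hp : p ∈ Ω) {s : ι → ℝ} {a b : ι}
    (hs : ∀ d, ∑ c, G d c p * s c = 1 / 2 * weylKoszul E G w d a b p) (c : ι) :
    s c = weylCoeff E G w c a b p := by
  have hinv := Matrix.nonsing_inv_mul (Matrix.of fun i j => G i j p)
    (isUnit_iff_ne_zero.2 (h.det_ne_zero hp))
  have h1 : (Matrix.of fun i j => G i j p).mulVec s =
      (Matrix.of fun i j => G i j p).mulVec (fun c => weylCoeff E G w c a b p) := by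
    ext d
    simpa [Matrix.mulVec, dotProduct, h.sum_metric_mul_weylCoeff hp] using hs d
  have h2 := congrArg (Matrix.of fun i j => G i j p)⁻¹.mulVec h1
  simp only [Matrix.mulVec_mulVec, hinv, Matrix.one_mulVec] at h2
  exact congrFun h2 c

/-- Adding the Koszul expressions with `a` and `b` exchanged cancels everything except the
derivative of `G a b` along `E d` and the `w d` term. This is metric compatibility in components. -/
theorem fderiv_metric_frame (h : AdaptedFrame Ω P g W E ε G w) {p : V} (hp : p ∈ Ω) (d a b : ι) :
    fderiv ℝ (G a b) p (E d p) + w d p * G a b p =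
      ∑ c, G a c p * weylCoeff E G w c d b p + ∑ c, G b c p * weylCoeff E G w c d a p := by
  rw [h.sum_metric_mul_weylCoeff hp, h.sum_metric_mul_weylCoeff hp]
  simp only [weylKoszul]
  rw [h.fderiv_metric_symm hp d b, h.fderiv_metric_symm hp d a, h.fderiv_metric_symm hp b a,
    h.metric_symm hp d b, h.metric_symm hp d a, h.metric_symm hp b a]
  ring

theorem contDiffOn_weylCoeff (h : AdaptedFrame Ω P g W E ε G w) (c a b : ι) :
    ContDiffOn ℝ ∞ (weylCoeff E G w c a b) Ω := by
  have hd : ∀ a b c, ContDiffOn ℝ ∞ (fun p => fderiv ℝ (G a b) p (E c p)) Ω := fun a b c =>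
    contDiffOn_fderiv_apply h.isOpen (h.smooth_metric a b) (h.smooth_frame c)
  have hw : ∀ a b c, ContDiffOn ℝ ∞ (fun p => w c p * G a b p) Ω := fun a b c =>
    (h.smooth_form c).mul (h.smooth_metric a b)
  refine contDiffOn_const.mul (ContDiffOn.sum fun d _ => ContDiffOn.mul
    (contDiffOn_inv_apply h.smooth_metric (fun p hp => h.det_ne_zero hp) c d) ?_)
  exact (((hd _ _ _).add (hd _ _ _)).sub (hd _ _ _)).add
    (((hw _ _ _).add (hw _ _ _)).sub (hw _ _ _))

end Coefficients

/-! ### Existence of the Weyl connection. -/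

section Existence

variable {Γ : ι → ι → ι → V → ℝ}

theorem proj_frameConnection (h : AdaptedFrame Ω P g W E ε G w) (X Y : V → V) (p : V) :
    P p (frameConnection P E ε Γ X Y p) = frameConnection P E ε Γ X Y p := by
  rw [frameConnection, h.proj_add, h.proj_sum, h.proj_proj]

theorem dual_frameConnection (h : AdaptedFrame Ω P g W E ε G w) (X Y : V → V) (p : V) (c : ι) :
    ε c p (frameConnection P E ε Γ X Y p) = fderiv ℝ (fun q => ε c q (Y q)) p (P p (X p))
      + ∑ a, ∑ b, Γ c a b p * (ε a p (X p) * ε b p (Y p))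
      + ε c p (VectorField.lieBracket ℝ (X - proj P X) Y p) := by
  rw [frameConnection, map_add, h.dual_sum, h.dual_proj]

theorem isLinearConnection (h : AdaptedFrame Ω P g W E ε G w)
    (hΓ : ∀ c a b, ContDiffOn ℝ ∞ (Γ c a b) Ω) :
    IsLinearConnection Ω P (frameConnection P E ε Γ) where
  isSection X Y hX hY := by
    refine ⟨?_, fun p _ => h.proj_frameConnection X Y p⟩
    refine ContDiffOn.add (ContDiffOn.sum fun c _ => ContDiffOn.smul (ContDiffOn.add ?_ ?_)
      (h.smooth_frame c)) (h.isField_proj (h.isField_lieBracket ?_ hY.1))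
    · exact contDiffOn_fderiv_apply h.isOpen (h.contDiffOn_dual hY.1 c)
        (h.isField_proj hX)
    · exact ContDiffOn.sum fun a _ => ContDiffOn.sum fun b _ =>
        (hΓ c a b).mul ((h.contDiffOn_dual hX a).mul (h.contDiffOn_dual hY.1 b))
    · exact ContDiffOn.sub hX (h.isField_proj hX)
  add_left X X' Y hX hX' hY p hp := by
    refine h.ext_dual (h.proj_frameConnection ..)
      (by rw [h.proj_add, h.proj_frameConnection, h.proj_frameConnection]) fun c => ?_
    have e1 : (X + X') - proj P (X + X') = (X - proj P X) + (X' - proj P X') := by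
      ext q; simp only [proj, Pi.add_apply, Pi.sub_apply, h.proj_add]; abel
    rw [map_add]
    simp only [h.dual_frameConnection]
    rw [e1, VectorField.lieBracket_add_left
      (h.differentiableAt_sub_proj hX hp)
      (h.differentiableAt_sub_proj hX' hp)]
    simp only [Pi.add_apply, h.proj_add, map_add, add_mul, mul_add, Finset.sum_add_distrib]
    ring
  smul_left f X Y hf hX hY p hp := by
    refine h.ext_dual (h.proj_frameConnection ..)
      (by rw [h.proj_smul, h.proj_frameConnection]) fun c => ?_
    have e1 : (fun q => f q • X q) - proj P (fun q => f q • X q) =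
        fun q => f q • (X - proj P X) q := by
      ext q; simp only [proj, Pi.sub_apply, h.proj_smul, smul_sub]
    rw [map_smul]
    simp only [h.dual_frameConnection]
    rw [e1, VectorField.lieBracket_smul_left (h.differentiableAt hf hp)
      (h.differentiableAt_sub_proj hX hp)]
    -- The bracket with `f • (X - PX)` produces a derivative of `f` times `X - PX`, which the dual
    -- forms kill; hence linearity over functions in `X`.
    have e2 : ε c p ((X - proj P X) p) = 0 := by
      simp only [proj, Pi.sub_apply, map_sub, h.dual_proj, sub_self]
    have e3 : ∀ a b, Γ c a b p * (f p * ε a p (X p) * ε b p (Y p)) =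
      f p * (Γ c a b p * (ε a p (X p) * ε b p (Y p))) := fun a b => by ring
    simp only [h.proj_smul, map_add, map_smul, smul_eq_mul, e2, e3, ← Finset.mul_sum]
    ring
  add_right X Y Y' hX hY hY' p hp := by
    refine h.ext_dual (h.proj_frameConnection ..)
      (by rw [h.proj_add, h.proj_frameConnection, h.proj_frameConnection]) fun c => ?_
    rw [map_add]
    simp only [h.dual_frameConnection]
    rw [VectorField.lieBracket_add_right (h.differentiableAt hY.1 hp)
      (h.differentiableAt hY'.1 hp)]
    simp only [Pi.add_apply, map_add, mul_add, Finset.sum_add_distrib]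
    rw [fderiv_fun_add (h.differentiableAt (h.contDiffOn_dual hY.1 c) hp)
      (h.differentiableAt (h.contDiffOn_dual hY'.1 c) hp), add_apply]
    ring
  leibniz f X Y hf hX hY p hp := by
    refine h.ext_dual (h.proj_frameConnection ..)
      (by rw [h.proj_add, h.proj_smul, h.proj_smul, h.proj_frameConnection, hY.2 p hp])
      fun c => ?_
    rw [map_add, map_smul, map_smul]
    simp only [h.dual_frameConnection]
    rw [VectorField.lieBracket_smul_right (h.differentiableAt hf hp)
      (h.differentiableAt hY.1 hp)]
    have e3 : ∀ a b, Γ c a b p * (ε a p (X p) * (f p * ε b p (Y p))) =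
      f p * (Γ c a b p * (ε a p (X p) * ε b p (Y p))) := fun a b => by ring
    simp only [map_add, map_smul, smul_eq_mul, e3, ← Finset.mul_sum]
    -- The first summand differentiates `f` along `PX` and the bracket differentiates it along `X -
    -- PX`; together they give the derivative along `X`.
    rw [fderiv_fun_mul (h.differentiableAt hf hp)
      (h.differentiableAt (h.contDiffOn_dual hY.1 c) hp)]
    simp only [add_apply, smul_apply, smul_eq_mul,
      Pi.sub_apply, map_sub, proj]
    ring

theorem sub_proj_proj (h : AdaptedFrame Ω P g W E ε G w) (X : V → V) :
    proj P X - proj P (proj P X) = 0 := by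
  ext q; simp [proj, h.proj_proj]

theorem isTorsionFree (h : AdaptedFrame Ω P g W E ε G w)
    (hΓ : ∀ p ∈ Ω, ∀ c a b, Γ c a b p = Γ c b a p) :
    IsTorsionFree Ω P (frameConnection P E ε Γ) := by
  intro X Y hX hY p hp
  refine h.ext_dual (h.proj_frameConnection ..)
      (by rw [h.proj_add, h.proj_proj, h.proj_frameConnection]) fun c => ?_
  -- The bracket with `X - PX` is built into the connection; the bracket with `PX` is given by
  -- `dual_lieBracket_proj`, and the quadratic terms cancel because `Γ` is symmetric.
  have e1 : X = (X - proj P X) + proj P X := by abel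
  have e2 := h.dual_lieBracket_proj hX hY hp c
  have e3 : VectorField.lieBracket ℝ X (proj P Y) p =
      VectorField.lieBracket ℝ (X - proj P X) (proj P Y) p
        + VectorField.lieBracket ℝ (proj P X) (proj P Y) p := by
    conv_lhs => rw [e1]
    rw [VectorField.lieBracket_add_left
      (h.differentiableAt_sub_proj hX hp)
      (h.differentiableAt (h.isField_proj hX) hp)]
  rw [map_add, h.dual_proj, e3, map_add, e2, h.dual_frameConnection, h.dual_frameConnection,
    h.sub_proj_proj, VectorField.lieBracket_zero_left]
  simp only [proj, h.dual_proj, h.proj_proj, Pi.zero_apply, map_zero]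
  have e4 : ∑ a, ∑ b, Γ c a b p * (ε a p (X p) * ε b p (Y p)) =
      ∑ a, ∑ b, Γ c a b p * (ε a p (Y p) * ε b p (X p)) := by
    rw [Finset.sum_comm]
    refine Finset.sum_congr rfl fun a _ => Finset.sum_congr rfl fun b _ => ?_
    rw [hΓ p hp c b a]; ring
  rw [e4]; ring

theorem isWeylCompatible (h : AdaptedFrame Ω P g W E ε G w) :
    IsWeylCompatible Ω P g W (frameConnection P E ε (weylCoeff E G w)) := by
  intro X Y Z hX hY hZ p hp
  set v := P p (X p) with hv
  -- The connection matrix in the direction `v = PX`. The complementary part of `PX` is zero, so the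
  -- bracket term does not contribute.
  set A : ι → ι → ℝ := fun c b => ∑ d, weylCoeff E G w c d b p * ε d p (X p) with hA
  have hdual : ∀ Y : V → V, ∀ c, ε c p (frameConnection P E ε (weylCoeff E G w) (proj P X) Y p) =
      fderiv ℝ (fun q => ε c q (Y q)) p v + ∑ b, A c b * ε b p (Y p) := by
    intro Y c
    rw [h.dual_frameConnection, h.sub_proj_proj, VectorField.lieBracket_zero_left]
    simp only [proj, h.dual_proj, h.proj_proj, Pi.zero_apply, map_zero, add_zero, hv, hA,
      Finset.sum_mul]
    rw [Finset.sum_comm]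
    congr 1
    exact Finset.sum_congr rfl fun b _ => Finset.sum_congr rfl fun d _ => by ring
  have hg : fderiv ℝ (fun q => g q (Y q) (Z q)) p v = ∑ a, ∑ b,
      (fderiv ℝ (G a b) p v * (ε a p (Y p) * ε b p (Z p)) + G a b p *
        (fderiv ℝ (fun q => ε a q (Y q)) p v * ε b p (Z p)
          + ε a p (Y p) * fderiv ℝ (fun q => ε b q (Z q)) p v)) := by
    have e1 : (fun q => g q (Y q) (Z q)) =ᶠ[nhds p]
        fun q => ∑ a, ∑ b, G a b q * (ε a q (Y q) * ε b q (Z q)) :=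
      Filter.eventuallyEq_of_mem (h.isOpen.mem_nhds hp)
        fun q hq => h.metric_eq q _ _ (hY.2 q hq) (hZ.2 q hq)
    have hd : ∀ a b, HasFDerivAt (fun q => G a b q * (ε a q (Y q) * ε b q (Z q))) _ p :=
      fun a b => (h.differentiableAt (h.smooth_metric a b) hp).hasFDerivAt.fun_mul
        ((h.differentiableAt (h.contDiffOn_dual hY.1 a) hp).hasFDerivAt.fun_mul
          (h.differentiableAt (h.contDiffOn_dual hZ.1 b) hp).hasFDerivAt)
    rw [e1.fderiv_eq, (HasFDerivAt.fun_sum fun a _ => HasFDerivAt.fun_sum fun b _ =>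
      hd a b).fderiv]
    simp only [sum_apply, add_apply, smul_apply, smul_eq_mul]
    exact Finset.sum_congr rfl fun a _ => Finset.sum_congr rfl fun b _ => by ring
  have hGv : ∀ a b, fderiv ℝ (G a b) p v + W p v * G a b p =
      ∑ c, G a c p * A c b + ∑ c, G b c p * A c a := by
    intro a b
    have e1 : fderiv ℝ (G a b) p v + W p v * G a b p =
        ∑ d, ε d p (X p) * (fderiv ℝ (G a b) p (E d p) + w d p * G a b p) := by
      rw [h.form_eq p v (h.proj_proj p _), hv]
      simp only [h.dual_proj]
      rw [h.proj_eq]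
      simp only [map_sum, map_smul, smul_eq_mul, Finset.sum_mul, mul_add, Finset.sum_add_distrib]
      congr 1
      exact Finset.sum_congr rfl fun d _ => by ring
    rw [e1]
    simp only [h.fderiv_metric_frame hp, mul_add, Finset.sum_add_distrib, Finset.mul_sum, hA]
    congr 1
    all_goals
      rw [Finset.sum_comm]
      exact Finset.sum_congr rfl fun d _ => Finset.sum_congr rfl fun c _ => by ring
  change fderiv ℝ (fun q => g q (Y q) (Z q)) p v - _ - _ + W p v * _ = 0
  rw [hg, h.metric_eq p _ _ (h.proj_frameConnection ..) (hZ.2 p hp),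
    h.metric_eq p _ _ (hY.2 p hp) (h.proj_frameConnection ..),
    h.metric_eq p _ _ (hY.2 p hp) (hZ.2 p hp)]
  simp only [hdual]
  exact sum_metric_identity (fun a b => h.metric_symm hp a b) hGv _ _ _ _

theorem isWeylConnection (h : AdaptedFrame Ω P g W E ε G w) :
    IsWeylConnection Ω P g W (frameConnection P E ε (weylCoeff E G w)) :=
  ⟨h.isLinearConnection h.contDiffOn_weylCoeff, h.isWeylCompatible,
    h.isTorsionFree fun _ hp => h.weylCoeff_swap hp⟩

end Existence

/-! ### Uniqueness: the coefficients are forced. -/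

/-- The coefficients of a Weyl connection in an adapted frame. -/
theorem weylConnection_frame (h : AdaptedFrame Ω P g W E ε G w)
    {D : (V → V) → (V → V) → V → V} (hD : IsWeylConnection Ω P g W D) {p : V} (hp : p ∈ Ω)
    (a b : ι) : D (E b) (E a) p = ∑ c, weylCoeff E G w c a b p • E c p := by
  have hPE : ∀ a, proj P (E a) = E a := fun a => funext fun q => h.proj_frame q a
  have hsec : ∀ a b, P p (D (E a) (E b) p) = D (E a) (E b) p := fun a b =>
    (hD.linear.isSection _ _ (h.smooth_frame a) (h.isSection_frame b)).2 p hp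
  have hsymm : ∀ a b, D (E a) (E b) p = D (E b) (E a) p := by
    intro a b
    have := hD.torsionFree (E a) (E b) (h.smooth_frame a) (h.smooth_frame b) p hp
    rwa [hPE, hPE, h.bracket p hp, add_zero] at this
  -- `s a b d` is the metric pairing of `∇_{E a} E b` with `E d`, symmetric in `a`, `b` by
  -- torsion-freeness.
  set s : ι → ι → ι → ℝ := fun a b d => ∑ c, G d c p * ε c p (D (E a) (E b) p) with hs
  have hcompat : ∀ d a b, fderiv ℝ (G a b) p (E d p) - s d a b - s d b a + w d p * G a b p = 0 := by
    intro d a b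
    have := hD.compatible (E d) (E a) (E b) (h.smooth_frame d) (h.isSection_frame a)
      (h.isSection_frame b) p hp
    have e1 : (fun q => g q (E a q) (E b q)) = G a b := by
      funext q
      rw [h.metric_eq q _ _ (h.proj_frame q a) (h.proj_frame q b)]
      simp [h.dual]
    rw [hPE, e1, congrFun e1 p, h.metric_eq p _ _ (hsec d a) (h.proj_frame p b),
      h.metric_eq p _ _ (h.proj_frame p a) (hsec d b), h.form_eq p _ (h.proj_frame p d)] at this
    simp only [h.dual, mul_ite, ite_mul, mul_one, one_mul, mul_zero, zero_mul, Finset.sum_ite_eq',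
      Finset.mem_univ, if_true, Finset.sum_ite_irrel, Finset.sum_const_zero] at this
    rw [hs]
    simp only [h.metric_symm hp b]
    exact this
  have hs' : ∀ a b d, s a b d = s b a d := fun a b d => by simp only [hs, hsymm a b]
  have hcoef := h.eq_weylCoeff hp (s := fun c => ε c p (D (E b) (E a) p)) (a := a) (b := b) ?_
  · refine h.ext_dual (hsec b a) (h.proj_sum p _) fun c => ?_
    rw [h.dual_sum]; exact hcoef c
  · intro d
    change s b a d = _
    simp only [weylKoszul]
    -- Koszul trick: in `h1 + h2 - h3` the symmetry of `s` leaves only `2 * s b a d`.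
    have h1 := hcompat a d b
    have h2 := hcompat b a d
    have h3 := hcompat d a b
    rw [hs' d a b, hs' d b a] at h3
    rw [hs' a b d] at h1
    linarith

end AdaptedFrame

end FrameConnection

/-! ### Finsler geometry in one coordinate domain. -/

section LocalFinsler

variable {n : ℕ}

/-- `L` is the local expression of a Finsler function over the coordinate domain `U`. -/
structure IsLocalFinsler (U : Set (Coord n)) (Ω : Set (TCoord n)) (L : TCoord n → ℝ) : Prop where
  isOpen : IsOpen U
  domain_eq : Ω = {p | p.1 ∈ U ∧ p.2 ≠ 0}
  smooth : ContDiffOn ℝ ∞ L Ω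
  homogeneous : ∀ (x y : Coord n) (t : ℝ), 0 < t → L (x, t • y) = t * L (x, y)
  posDef : ∀ p ∈ Ω, (gMat L p).PosDef

/-- The form `δy^a` as a continuous linear form. -/
noncomputable def deltaYL (L : TCoord n → ℝ) (a : Fin n) (p : TCoord n) : TCoord n →L[ℝ] ℝ :=
  (EuclideanSpace.proj a).comp (ContinuousLinearMap.snd ℝ (Coord n) (Coord n))
    + ∑ b, nlc L a b p •
      (EuclideanSpace.proj b).comp (ContinuousLinearMap.fst ℝ (Coord n) (Coord n))

/-- The form `dx^a` as a continuous linear form. -/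
noncomputable def dxL (a : Fin n) : TCoord n →L[ℝ] ℝ :=
  (EuclideanSpace.proj a).comp (ContinuousLinearMap.fst ℝ (Coord n) (Coord n))

theorem deltaYL_apply (L : TCoord n → ℝ) (a : Fin n) (p ξ : TCoord n) :
    deltaYL L a p ξ = deltaY L a p ξ := by
  simp [deltaYL, deltaY, sum_apply]

theorem dxL_apply (a : Fin n) (ξ : TCoord n) : dxL a ξ = ξ.1 a := by
  simp [dxL]

theorem e_apply (a b : Fin n) : e a b = if b = a then (1 : ℝ) else 0 := by
  simp [e]

theorem deltaField_eq (L : TCoord n → ℝ) (a : Fin n) (p : TCoord n) :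
    deltaField L a p = ((e a, 0) : TCoord n) - ∑ b, nlc L b a p • ((0, e b) : TCoord n) := by
  ext i <;> simp [deltaField, Prod.fst_sum, Prod.snd_sum]

theorem deltaY_deltaField (L : TCoord n → ℝ) (a b : Fin n) (p : TCoord n) :
    deltaY L a p (deltaField L b p) = 0 := by
  simp [deltaY, deltaField, e_apply]

theorem fderiv_deltaField (L : TCoord n → ℝ) (a : Fin n) (f : TCoord n → ℝ) (p : TCoord n) :
    fderiv ℝ f p (deltaField L a p) = ddelta L a f p := by
  rw [deltaField_eq]
  simp only [map_sub, map_sum, map_smul, smul_eq_mul]; rfl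

theorem vert_deltaField (L : TCoord n → ℝ) (a : Fin n) : proj (vert L) (deltaField L a) = 0 := by
  funext p
  simp only [proj, vert, deltaY_deltaField, zero_smul, Finset.sum_const_zero]; rfl

theorem horiz_deltaField (L : TCoord n → ℝ) (a : Fin n) :
    proj (horiz L) (deltaField L a) = deltaField L a := by
  funext p
  simp [proj, horiz, show (deltaField L a p).1 = e a from rfl, e_apply]

theorem sum_mul_dy (f : TCoord n → ℝ) (p : TCoord n) :
    ∑ a, p.2 a * dy a f p = fderiv ℝ f p (0, p.2) := by
  have : ((0, p.2) : TCoord n) = ∑ a, p.2 a • ((0, e a) : TCoord n) := by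
    ext i <;> simp [Prod.fst_sum, Prod.snd_sum, e_apply]
  rw [this]; simp only [map_sum, map_smul, smul_eq_mul]; rfl

theorem hasDerivAt_scale (p : TCoord n) : HasDerivAt (fun t : ℝ => ((p.1, t • p.2) : TCoord n))
    ((0, p.2) : TCoord n) 1 := by
  have h1 := (hasDerivAt_const (1 : ℝ) p.1).prodMk ((hasDerivAt_id (1 : ℝ)).smul_const p.2)
  simpa using h1

/-- Euler's identity for a function which is homogeneous of degree `k` in `y`. -/
theorem euler_identity {f : TCoord n → ℝ} {p : TCoord n} {k : ℕ} (hf : DifferentiableAt ℝ f p)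
    (hk : ∀ t : ℝ, 0 < t → f (p.1, t • p.2) = t ^ k * f p) :
    ∑ a, p.2 a * dy a f p = k * f p := by
  rw [sum_mul_dy]
  -- The derivative at `t = 1` of `f (x, t y)` is computed by the chain rule and from homogeneity.
  have h1 : HasDerivAt (fun t : ℝ => f (p.1, t • p.2)) (fderiv ℝ f p (0, p.2)) 1 := by
    have h2 : HasFDerivAt f (fderiv ℝ f p) ((p.1, (1 : ℝ) • p.2) : TCoord n) := by
      simpa using hf.hasFDerivAt
    exact h2.comp_hasDerivAt 1 (hasDerivAt_scale p)
  have h3 : HasDerivAt (fun t : ℝ => t ^ k * f p) (k * f p) 1 := by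
    simpa using (hasDerivAt_pow k (1 : ℝ)).mul_const (f p)
  have h4 : (fun t : ℝ => f (p.1, t • p.2)) =ᶠ[nhds 1] fun t => t ^ k * f p :=
    Filter.eventuallyEq_of_mem (lt_mem_nhds one_pos) fun t ht => hk t ht
  exact h1.unique (h3.congr_of_eventuallyEq h4)

/-- A function that does not depend on `x` has vanishing `x`-derivatives. -/
theorem dx_eq_zero {U : Set (Coord n)} (hU : IsOpen U) {f : TCoord n → ℝ} {p : TCoord n}
    (hp : p.1 ∈ U) (hp2 : p.2 ≠ 0) (hf : DifferentiableAt ℝ f p)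
    (h : ∀ x ∈ U, ∀ x' ∈ U, ∀ y : Coord n, y ≠ 0 → f (x, y) = f (x', y)) (a : Fin n) :
    dx a f p = 0 := by
  have h1 : f =ᶠ[nhds p] fun q => f (p.1, q.2) := by
    refine Filter.eventuallyEq_of_mem (((hU.preimage continuous_fst).inter
      (isOpen_ne.preimage continuous_snd)).mem_nhds ⟨hp, hp2⟩) ?_
    exact fun q hq => h q.1 hq.1 p.1 hp q.2 hq.2
  have h2 : HasFDerivAt (fun q : TCoord n => ((p.1, q.2) : TCoord n)) _ p :=
    (hasFDerivAt_const p.1 p).prodMk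
      (ContinuousLinearMap.snd ℝ (Coord n) (Coord n)).hasFDerivAt
  have h3 : HasFDerivAt (fun q : TCoord n => f (p.1, q.2)) _ p := hf.hasFDerivAt.comp p h2
  rw [dx, h1.fderiv_eq, h3.fderiv]
  have h4 : ((0, 0) : TCoord n) = 0 := rfl
  simp [ContinuousLinearMap.comp_apply, h4]

/-! ### Adapted frames, the Cartan form and the horizontal coefficients. -/

namespace IsLocalFinsler

variable {U : Set (Coord n)} {Ω : Set (TCoord n)} {L : TCoord n → ℝ}

theorem isOpen_domain (h : IsLocalFinsler U Ω L) : IsOpen Ω := by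
  rw [h.domain_eq]
  exact (h.isOpen.preimage continuous_fst).inter (isOpen_ne.preimage continuous_snd)

theorem contDiffOn_dx (h : IsLocalFinsler U Ω L) {f : TCoord n → ℝ} (hf : ContDiffOn ℝ ∞ f Ω)
    (a : Fin n) : ContDiffOn ℝ ∞ (dx a f) Ω :=
  contDiffOn_fderiv_apply h.isOpen_domain hf contDiffOn_const

theorem contDiffOn_dy (h : IsLocalFinsler U Ω L) {f : TCoord n → ℝ} (hf : ContDiffOn ℝ ∞ f Ω)
    (a : Fin n) : ContDiffOn ℝ ∞ (dy a f) Ω :=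
  contDiffOn_fderiv_apply h.isOpen_domain hf contDiffOn_const

theorem contDiffOn_sqF (h : IsLocalFinsler U Ω L) : ContDiffOn ℝ ∞ (sqF L) Ω := h.smooth.pow 2

theorem contDiffOn_gLow (h : IsLocalFinsler U Ω L) (a b : Fin n) :
    ContDiffOn ℝ ∞ (gLow L a b) Ω :=
  contDiffOn_const.mul (h.contDiffOn_dy (h.contDiffOn_dy h.contDiffOn_sqF b) a)

theorem contDiffOn_gUp (h : IsLocalFinsler U Ω L) (a b : Fin n) :
    ContDiffOn ℝ ∞ (gUp L a b) Ω :=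
  contDiffOn_inv_apply h.contDiffOn_gLow (fun p hp => (h.posDef p hp).det_pos.ne') a b

theorem contDiffOn_snd_apply (c : Fin n) : ContDiffOn ℝ ∞ (fun p : TCoord n => p.2 c) Ω :=
  ((EuclideanSpace.proj c : Coord n →L[ℝ] ℝ).contDiff.comp contDiff_snd).contDiffOn

theorem contDiffOn_spray (h : IsLocalFinsler U Ω L) (a : Fin n) :
    ContDiffOn ℝ ∞ (spray L a) Ω := by
  refine contDiffOn_const.mul (ContDiffOn.sum fun b _ => (h.contDiffOn_gUp a b).mul
    (ContDiffOn.sub (ContDiffOn.sum fun c _ => ContDiffOn.mul ?_ (contDiffOn_snd_apply c)) ?_))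
  · exact h.contDiffOn_dy (h.contDiffOn_dx h.contDiffOn_sqF c) b
  · exact h.contDiffOn_dx h.contDiffOn_sqF b

theorem contDiffOn_nlc (h : IsLocalFinsler U Ω L) (a b : Fin n) :
    ContDiffOn ℝ ∞ (nlc L a b) Ω := h.contDiffOn_dy (h.contDiffOn_spray a) b

theorem contDiffOn_deltaField (h : IsLocalFinsler U Ω L) (a : Fin n) :
    ContDiffOn ℝ ∞ (deltaField L a) Ω :=
  contDiffOn_const.prodMk (ContDiffOn.sum fun b _ =>
    (h.contDiffOn_nlc b a).smul contDiffOn_const).neg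

/-- The fields `δ/δx^a` form an adapted frame of the horizontal distribution. -/
theorem adaptedFrame_horiz (h : IsLocalFinsler U Ω L) :
    AdaptedFrame Ω (horiz L) (sasaki L) (cartanForm L) (deltaField L) (fun a _ => dxL a)
      (gLow L) (fun a p => 1 / 2 * dy a (sqF L) p) where
  isOpen := h.isOpen_domain
  proj_eq p ξ := by simp only [dxL_apply]; rfl
  dual p a b := by simp [dxL_apply, deltaField, e_apply]
  smooth_frame := h.contDiffOn_deltaField
  smooth_dual a := contDiffOn_const
  smooth_metric := h.contDiffOn_gLow
  smooth_form a := contDiffOn_const.mul (h.contDiffOn_dy h.contDiffOn_sqF a)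
  posDef := h.posDef
  metric_eq p ξ η hξ hη := by
    have key : ∀ ξ, horiz L p ξ = ξ → ∀ a, deltaY L a p ξ = 0 := by
      intro ξ hξ a
      rw [← hξ, ← deltaYL_apply, horiz]
      simp [map_sum, deltaYL_apply, deltaY_deltaField]
    simp [sasaki, key ξ hξ, dxL_apply]
  form_eq p ξ _ := by simp only [dxL_apply]; rfl
  bracket p hp a b := by
    -- The `x`-part of `δ/δx^a` is the constant `e a`, so brackets of these fields are vertical.
    have key : ∀ a v, (fderiv ℝ (deltaField L a) p v).1 = 0 := by
      intro a v
      have hd := ((h.contDiffOn_deltaField a).contDiffAt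
        (h.isOpen_domain.mem_nhds hp)).differentiableAt (by simp)
      have h1 : HasFDerivAt (fun q => (deltaField L a q).1) _ p := hd.hasFDerivAt.fst
      have h2 : HasFDerivAt (fun q => (deltaField L a q).1) (0 : TCoord n →L[ℝ] Coord n) p :=
        hasFDerivAt_const (e a) p
      exact congrArg (fun T : TCoord n →L[ℝ] Coord n => T v) (h1.unique h2)
    simp [horiz, VectorField.lieBracket, key]

/-- The fields `∂/∂y^a` form an adapted frame of the vertical distribution. -/
theorem adaptedFrame_vert (h : IsLocalFinsler U Ω L) :
    AdaptedFrame Ω (vert L) (sasaki L) (cartanForm L) (fun a _ => ((0, e a) : TCoord n))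
      (deltaYL L) (gLow L) (fun _ _ => 0) where
  isOpen := h.isOpen_domain
  proj_eq p ξ := by
    ext i <;> simp [vert, deltaYL_apply, Prod.fst_sum, Prod.snd_sum]
  dual p a b := by simp [deltaYL_apply, deltaY, e_apply]
  smooth_frame a := contDiffOn_const
  smooth_dual a := contDiffOn_const.add (ContDiffOn.sum fun b _ =>
    (h.contDiffOn_nlc a b).smul contDiffOn_const)
  smooth_metric := h.contDiffOn_gLow
  smooth_form a := contDiffOn_const
  posDef := h.posDef
  metric_eq p ξ η hξ _ := by
    have : ξ.1 = 0 := by rw [← hξ]; rfl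
    simp [sasaki, this, deltaYL_apply]
  -- The Cartan form involves only the `dx^a`, so it is zero on vertical vectors: the vertical Weyl
  -- connection has `w = 0`.
  form_eq p ξ hξ := by
    have : ξ.1 = 0 := by rw [← hξ]; rfl
    simp [cartanForm, this]
  bracket p _ a b := by
    have : VectorField.lieBracket ℝ (fun _ => ((0, e a) : TCoord n)) (fun _ => (0, e b)) p = 0 := by
      simp [VectorField.lieBracket]
    rw [this]
    simp [vert, deltaY]

theorem exists_isVranceanuConnection (h : IsLocalFinsler U Ω L) :
    ∃ D, IsVranceanuConnection Ω (vert L) (horiz L) (sasaki L) (cartanForm L) D :=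
  ⟨_, _, _, h.adaptedFrame_vert.isWeylConnection, h.adaptedFrame_horiz.isWeylConnection,
    fun _ _ _ _ _ _ => rfl⟩

theorem isVranceanuConnection_deltaField (h : IsLocalFinsler U Ω L)
    {D : (TCoord n → TCoord n) → (TCoord n → TCoord n) → TCoord n → TCoord n}
    (hD : IsVranceanuConnection Ω (vert L) (horiz L) (sasaki L) (cartanForm L) D)
    {p : TCoord n} (hp : p ∈ Ω) (a b : Fin n) :
    D (deltaField L b) (deltaField L a) p =
      ∑ c, weylCoeff (deltaField L) (gLow L) (fun a p => 1 / 2 * dy a (sqF L) p) c a b p •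
        deltaField L c p := by
  obtain ⟨D₁, D₂, h₁, h₂, hD⟩ := hD
  rw [hD _ _ (h.contDiffOn_deltaField b) (h.contDiffOn_deltaField a) p hp, vert_deltaField,
    horiz_deltaField, h.adaptedFrame_horiz.weylConnection_frame h₂ hp]
  -- The vertical part of `δ/δx^a` is the zero section, and additivity applied to `0 + 0 = 0` shows
  -- that its covariant derivative is zero.
  have hz : IsSection Ω (vert L) (0 : TCoord n → TCoord n) :=
    ⟨contDiffOn_const, fun p _ => by simp [vert, deltaY]⟩
  have := h₁.linear.add_right (deltaField L b) 0 0 (h.contDiffOn_deltaField b) hz hz p hp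
  rw [add_zero, left_eq_add] at this
  rw [this, zero_add]

theorem differentiableAt (h : IsLocalFinsler U Ω L) {f : TCoord n → ℝ} (hf : ContDiffOn ℝ ∞ f Ω)
    {p : TCoord n} (hp : p ∈ Ω) : DifferentiableAt ℝ f p :=
  h.adaptedFrame_horiz.differentiableAt hf hp

theorem gLow_symm (h : IsLocalFinsler U Ω L) {p : TCoord n} (hp : p ∈ Ω) (a b : Fin n) :
    gLow L a b p = gLow L b a p := h.adaptedFrame_horiz.metric_symm hp a b

theorem sqF_scale (h : IsLocalFinsler U Ω L) (x y : Coord n) {t : ℝ} (ht : 0 < t) :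
    sqF L (x, t • y) = t ^ 2 * sqF L (x, y) := by
  rw [sqF, sqF, h.homogeneous x y t ht]; ring

theorem scale_mem (h : IsLocalFinsler U Ω L) {p : TCoord n} (hp : p ∈ Ω) {t : ℝ} (ht : 0 < t) :
    ((p.1, t • p.2) : TCoord n) ∈ Ω := by
  rw [h.domain_eq] at hp ⊢
  exact ⟨hp.1, smul_ne_zero ht.ne' hp.2⟩

/-- Differentiating `F²(x, t y) = t² F²(x, y)` in `y` yields a factor `t` on the left, which cancels
one of the two on the right. Euler's identity then applies with degree one. -/
theorem dy_sqF_scale (h : IsLocalFinsler U Ω L) {p : TCoord n} (hp : p ∈ Ω) (b : Fin n) {t : ℝ}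
    (ht : 0 < t) : dy b (sqF L) (p.1, t • p.2) = t * dy b (sqF L) p := by
  have h1 : HasFDerivAt (fun q : TCoord n => ((q.1, t • q.2) : TCoord n)) _ p :=
    (ContinuousLinearMap.fst ℝ (Coord n) (Coord n)).hasFDerivAt.prodMk
      ((ContinuousLinearMap.snd ℝ (Coord n) (Coord n)).hasFDerivAt.const_smul t)
  have h2 : HasFDerivAt (fun q : TCoord n => sqF L (q.1, t • q.2)) _ p :=
    HasFDerivAt.comp (f := fun q : TCoord n => ((q.1, t • q.2) : TCoord n)) p
      (h.differentiableAt h.contDiffOn_sqF (h.scale_mem hp ht)).hasFDerivAt h1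
  have h3 : HasFDerivAt (fun q : TCoord n => sqF L (q.1, t • q.2))
      (t ^ 2 • fderiv ℝ (sqF L) p) p := by
    simp only [h.sqF_scale _ _ ht]
    exact (h.differentiableAt h.contDiffOn_sqF hp).hasFDerivAt.const_mul (t ^ 2)
  have h4 := congrArg (fun T : TCoord n →L[ℝ] ℝ => T (0, e b)) (h2.unique h3)
  have h5 : ((0, t • e b) : TCoord n) = t • ((0, e b) : TCoord n) := by simp
  simp [ContinuousLinearMap.comp_apply, h5, -Prod.smul_mk] at h4
  have h6 : t * dy b (sqF L) (p.1, t • p.2) = t ^ 2 * dy b (sqF L) p := h4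
  exact mul_left_cancel₀ ht.ne' (by rw [h6]; ring)

/-- The components of the Cartan form: `½ ∂F²/∂y^b = g_{ab} y^a`. -/
theorem half_dy_sqF (h : IsLocalFinsler U Ω L) {p : TCoord n} (hp : p ∈ Ω) (b : Fin n) :
    1 / 2 * dy b (sqF L) p = ∑ a, p.2 a * gLow L a b p := by
  have := euler_identity (k := 1) (h.differentiableAt (h.contDiffOn_dy h.contDiffOn_sqF b) hp)
    (fun t ht => by rw [pow_one, h.dy_sqF_scale hp b ht])
  rw [Nat.cast_one, one_mul] at this
  rw [← this, Finset.mul_sum]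
  exact Finset.sum_congr rfl fun a _ => by rw [gLow]; ring

/-- Euler's identity in degree two, combined with the one in degree one for `∂F²/∂y^b`. It recovers
`F²` from `g`, which carries independence of `x` from `g` over to `F²`. -/
theorem sqF_eq (h : IsLocalFinsler U Ω L) {p : TCoord n} (hp : p ∈ Ω) :
    sqF L p = ∑ b, p.2 b * ∑ a, p.2 a * gLow L a b p := by
  have := euler_identity (k := 2) (h.differentiableAt h.contDiffOn_sqF hp)
    (fun t ht => h.sqF_scale p.1 p.2 ht)
  simp only [← h.half_dy_sqF hp]
  have e1 : ∀ b, p.2 b * (1 / 2 * dy b (sqF L) p) = 1 / 2 * (p.2 b * dy b (sqF L) p) :=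
    fun b => by ring
  simp only [e1, ← Finset.mul_sum, this]
  push_cast; ring

/-- The horizontal coefficients of the Weyl connection of the horizontal distribution. -/
theorem weylCoeff_deltaField (h : IsLocalFinsler U Ω L) {p : TCoord n} (hp : p ∈ Ω)
    (c a b : Fin n) :
    weylCoeff (deltaField L) (gLow L) (fun a p => 1 / 2 * dy a (sqF L) p) c a b p =
      1 / 2 * ∑ d, gUp L c d p * (ddelta L a (gLow L d b) p + ddelta L b (gLow L a d) p
        - ddelta L d (gLow L a b) p) + yTerm L c a b p := by
  have hinv : ∀ b, ∑ d, gUp L c d p * gLow L d b p = if c = b then 1 else 0 := by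
    intro b
    have := congrFun₂ (Matrix.nonsing_inv_mul (gMat L p)
      (isUnit_iff_ne_zero.2 (h.posDef p hp).det_pos.ne')) c b
    simpa [Matrix.mul_apply, Matrix.one_apply, gMat, gUp] using this
  -- Raising the index of the Cartan form gives back the vector `y`.
  have hw : ∑ d, gUp L c d p * ∑ u, p.2 u * gLow L u d p = p.2 c := by
    have e1 : ∑ d, gUp L c d p * ∑ u, p.2 u * gLow L u d p =
        ∑ u, p.2 u * ∑ d, gUp L c d p * gLow L d u p := by
      simp only [Finset.mul_sum]
      rw [Finset.sum_comm]
      refine Finset.sum_congr rfl fun u _ => Finset.sum_congr rfl fun d _ => ?_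
      rw [h.gLow_symm hp u d]; ring
    rw [e1]; simp [hinv]
  have hy : yTerm L c a b p = 1 / 2 * ((∑ u, p.2 u * gLow L u a p) * (if c = b then 1 else 0)
      + (∑ u, p.2 u * gLow L u b p) * (if c = a then 1 else 0) - p.2 c * gLow L a b p) := by
    have : p.2 c = ∑ u, p.2 u * if c = u then 1 else 0 := by simp
    rw [this, yTerm, Finset.sum_mul, Finset.sum_mul, Finset.sum_mul, ← Finset.sum_add_distrib,
      ← Finset.sum_sub_distrib]
    congr 1
    refine Finset.sum_congr rfl fun u _ => ?_
    rw [h.gLow_symm hp a u]; ring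
  -- Kronecker deltas are written as `g^{cd} g_{db}` and `g^{cd} g_{da}`, so that both sides become
  -- a single sum over `d`.
  rw [hy, ← hinv b, ← hinv a, weylCoeff]
  simp only [weylKoszul, fderiv_deltaField, h.half_dy_sqF hp]
  rw [← mul_add]
  congr 1
  -- Naming the Cartan components keeps their inner sums from being expanded.
  obtain ⟨ν, hν⟩ : ∃ ν : Fin n → ℝ, ∀ d, ∑ u, p.2 u * gLow L u d p = ν d :=
    ⟨_, fun _ => rfl⟩
  simp only [hν] at hw ⊢
  rw [← hw, Finset.sum_mul, Finset.mul_sum, Finset.mul_sum, ← Finset.sum_add_distrib,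
    ← Finset.sum_sub_distrib, ← Finset.sum_add_distrib]
  refine Finset.sum_congr rfl fun d _ => ?_
  rw [h.gLow_symm hp a d]
  rw [gUp, gMat]; ring

theorem yTerm_swap (h : IsLocalFinsler U Ω L) {p : TCoord n} (hp : p ∈ Ω) (c a b : Fin n) :
    yTerm L c a b p = yTerm L c b a p := by
  rw [yTerm, yTerm]
  congr 1
  refine Finset.sum_congr rfl fun u _ => ?_
  rw [h.gLow_symm hp u b, h.gLow_symm hp a u, h.gLow_symm hp a b]; ring

theorem dy_eq_zero (h : IsLocalFinsler U Ω L) {f : TCoord n → ℝ} (hf : ∀ q ∈ Ω, f q = 0)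
    {p : TCoord n} (hp : p ∈ Ω) (a : Fin n) : dy a f p = 0 := by
  have : f =ᶠ[nhds p] fun _ => (0 : ℝ) :=
    Filter.eventuallyEq_of_mem (h.isOpen_domain.mem_nhds hp) hf
  rw [dy, this.fderiv_eq]; simp

/-! ### Charts in which `g` does not depend on `x`. -/

section Minkowski

variable (hM : ∀ x ∈ U, ∀ x' ∈ U, ∀ y : Coord n, y ≠ 0 → ∀ a b : Fin n,
  gLow L a b (x, y) = gLow L a b (x', y))
include hM

theorem dx_sqF_eq_zero (h : IsLocalFinsler U Ω L) {p : TCoord n} (hp : p ∈ Ω) (a : Fin n) :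
    dx a (sqF L) p = 0 := by
  have hp' := hp
  rw [h.domain_eq] at hp'
  refine dx_eq_zero h.isOpen hp'.1 hp'.2 (h.differentiableAt h.contDiffOn_sqF hp) ?_ a
  intro x hx x' hx' y hy
  have hm : ∀ x ∈ U, ((x, y) : TCoord n) ∈ Ω := fun x hx => by rw [h.domain_eq]; exact ⟨hx, hy⟩
  rw [h.sqF_eq (hm x hx), h.sqF_eq (hm x' hx')]
  simp only [hM x hx x' hx' y hy]

/-- Every term of the spray contains an `x`-derivative of `F²`, and these vanish on all of the open
set `Ω`, hence so do their `y`-derivatives. -/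
theorem spray_eq_zero (h : IsLocalFinsler U Ω L) {p : TCoord n} (hp : p ∈ Ω) (a : Fin n) :
    spray L a p = 0 := by
  have h1 : ∀ b c, dy b (dx c (sqF L)) p = 0 := fun b c =>
    h.dy_eq_zero (fun q hq => h.dx_sqF_eq_zero hM hq c) hp b
  simp [spray, h1, h.dx_sqF_eq_zero hM hp]

theorem ddelta_gLow_eq_zero (h : IsLocalFinsler U Ω L) {p : TCoord n} (hp : p ∈ Ω)
    (a b c : Fin n) : ddelta L c (gLow L a b) p = 0 := by
  have h1 : ∀ b c, nlc L b c p = 0 := fun b c =>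
    h.dy_eq_zero (fun q hq => h.spray_eq_zero hM hq b) hp c
  have hp' := hp
  rw [h.domain_eq] at hp'
  have h2 : dx c (gLow L a b) p = 0 :=
    dx_eq_zero h.isOpen hp'.1 hp'.2 (h.differentiableAt (h.contDiffOn_gLow a b) hp)
      (fun x hx x' hx' y hy => hM x hx x' hx' y hy a b) c
  simp [ddelta, h1, h2]

end Minkowski

end IsLocalFinsler

end LocalFinsler

/-! ### From the manifold to coordinates. -/

section Charts

variable {n : ℕ} {N : Type*} [TopologicalSpace N] [ChartedSpace (Coord n) N]
  [IsManifold (𝓡 n) ∞ N]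

/-- The map of slit tangent bundles induced by the inverse of a chart is smooth. -/
theorem contMDiffOn_tangent_chart_symm {φ : OpenPartialHomeomorph N (Coord n)}
    (hφ : φ ∈ IsManifold.maximalAtlas (𝓡 n) ∞ N) :
    ContMDiffOn 𝓘(ℝ, TCoord n) (𝓡 n).tangent ∞
      (fun p : TCoord n => (⟨φ.symm p.1, mfderiv (𝓡 n) (𝓡 n) φ.symm p.1 p.2⟩ :
        TangentBundle (𝓡 n) N)) (slitDomain φ) := by
  have : IsManifold (𝓡 n) 1 N := IsManifold.of_le (n := ∞) (by simp)
  have h1 := (contMDiffOn_symm_of_mem_maximalAtlas hφ).contMDiffOn_tangentMapWithin (m := ∞)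
    le_rfl φ.open_target.uniqueMDiffOn
  have h0 : ContMDiff 𝓘(ℝ, TCoord n) (𝓡 n).tangent ∞
      (fun p : TCoord n => (⟨p.1, p.2⟩ : TangentBundle (𝓡 n) (Coord n))) := by
    rw [modelWithCornersSelf_prod]
    exact contMDiff_tangentBundleModelSpaceHomeomorph_symm
  refine (h1.comp h0.contMDiffOn (s := slitDomain φ) fun p hp => hp.1).congr fun p hp => ?_
  change _ = tangentMapWithin (𝓡 n) (𝓡 n) φ.symm φ.target ⟨p.1, p.2⟩
  rw [tangentMapWithin, mfderivWithin_of_isOpen φ.open_target hp.1]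

theorem isLocalFinsler_localF {F : TangentBundle (𝓡 n) N → ℝ} (hF : IsFinsler F)
    {φ : OpenPartialHomeomorph N (Coord n)} (hφ : φ ∈ IsManifold.maximalAtlas (𝓡 n) ∞ N) :
    IsLocalFinsler φ.target (slitDomain φ) (localF F φ) where
  isOpen := φ.open_target
  domain_eq := rfl
  smooth := by
    have : IsManifold (𝓡 n) 1 N := IsManifold.of_le (n := ∞) (by simp)
    have hmd : φ.MDifferentiable (𝓡 n) (𝓡 n) :=
      ⟨(contMDiffOn_of_mem_maximalAtlas hφ).mdifferentiableOn (by simp),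
        (contMDiffOn_symm_of_mem_maximalAtlas hφ).mdifferentiableOn (by simp)⟩
    rw [← contMDiffOn_iff_contDiffOn]
    refine hF.smooth.comp (contMDiffOn_tangent_chart_symm hφ) fun p hp h0 => hp.2 ?_
    -- `F` is smooth only off the zero section; injectivity of the chart derivative keeps nonzero
    -- vectors nonzero.
    exact hmd.symm.mfderiv_injective hp.1 (h0.trans (map_zero _).symm)
  homogeneous x y t ht := by
    rw [localF, localF, ← hF.homogeneous _ _ t ht]
    congr 2
    exact map_smul _ t y
  posDef := hF.posDef φ hφ

end Charts

end FinslerWeyl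

/-- In every chart `φ` of a Finsler manifold the Vranceanu connection `∇*` of `(TN, F, θ_F)` exists;
its coefficients `F^c_{ab}`, given by `∇*_{δ/δx^b} δ/δx^a = F^c_{ab} δ/δx^c`, have the stated form
in all charts of a Landsberg space and in the distinguished charts of a locally Minkowski space. -/
theorem corollary3p6 {n : ℕ} {N : Type*} [TopologicalSpace N]
    [ChartedSpace (FinslerWeyl.Coord n) N] [IsManifold (𝓡 n) ∞ N]
    (F : TangentBundle (𝓡 n) N → ℝ) (hF : FinslerWeyl.IsFinsler F) :
    (∀ φ ∈ IsManifold.maximalAtlas (𝓡 n) ∞ N, ∃ D, FinslerWeyl.IsFinslerVranceanu F φ D) ∧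
    (FinslerWeyl.IsLandsberg F →
      ∀ φ ∈ IsManifold.maximalAtlas (𝓡 n) ∞ N, ∀ D, FinslerWeyl.IsFinslerVranceanu F φ D →
        ∀ p ∈ FinslerWeyl.slitDomain φ, ∀ a b : Fin n,
          D (FinslerWeyl.deltaField (FinslerWeyl.localF F φ) b)
              (FinslerWeyl.deltaField (FinslerWeyl.localF F φ) a) p
            = ∑ c, (FinslerWeyl.dy a
                    (FinslerWeyl.dy b (FinslerWeyl.spray (FinslerWeyl.localF F φ) c)) p
                  + FinslerWeyl.yTerm (FinslerWeyl.localF F φ) c a b p) •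
                FinslerWeyl.deltaField (FinslerWeyl.localF F φ) c p) ∧
    (∀ A, FinslerWeyl.IsMinkowskiCovering F A →
      ∀ φ ∈ A, ∀ D, FinslerWeyl.IsFinslerVranceanu F φ D →
        ∀ p ∈ FinslerWeyl.slitDomain φ, ∀ a b : Fin n,
          D (FinslerWeyl.deltaField (FinslerWeyl.localF F φ) b)
              (FinslerWeyl.deltaField (FinslerWeyl.localF F φ) a) p
            = ∑ c, FinslerWeyl.yTerm (FinslerWeyl.localF F φ) c a b p •
                FinslerWeyl.deltaField (FinslerWeyl.localF F φ) c p) := by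
  refine ⟨fun φ hφ => (FinslerWeyl.isLocalFinsler_localF hF hφ).exists_isVranceanuConnection,
    fun hL φ hφ D hD p hp a b => ?_, fun A hA φ hφA D hD p hp a b => ?_⟩
  · have h := FinslerWeyl.isLocalFinsler_localF hF hφ
    rw [h.isVranceanuConnection_deltaField hD hp]
    refine Finset.sum_congr rfl fun c _ => ?_
    -- With `a` and `b` exchanged, the Landsberg identity has right side `∂/∂y^a` of `G^c_b`, which
    -- is the wanted order of differentiation, so symmetry of second derivatives is not needed.
    rw [h.adaptedFrame_horiz.weylCoeff_swap hp, h.weylCoeff_deltaField hp, hL φ hφ p hp b a c,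
      h.yTerm_swap hp]
    rfl
  · have h := FinslerWeyl.isLocalFinsler_localF hF (hA.1 hφA)
    rw [h.isVranceanuConnection_deltaField hD hp]
    refine Finset.sum_congr rfl fun c _ => ?_
    rw [h.weylCoeff_deltaField hp]
    simp [h.ddelta_gLow_eq_zero (hA.2.2 φ hφA) hp]
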